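/- Let $f:\mathbb{R}^n\to\mathbb{R}$ be continuous and let $a_0<a_1<\dots<a_m$ be real numbers such that the sublevel sets $V_{a_j}=\{x: f(x)\le a_j\}$, $j=0,\dots,m$, are non-empty and compact. Put $\Gamma_{a_j}=\{x: f(x)=a_j\}$, $K=\bigcup_{j=0}^m\Gamma_{a_j}$ and $\Omega_i=\{x: a_i<f(x)<a_{i+1}\}$ for $0\le i\le m-1$. *Notation.* $|\cdot|$ is the Euclidean norm, $B(0;R)$ the open ball, $B^c(0;R)$ its complement, and $\mathrm{co}[g]$ is the convex envelope (the largest convex function $\le g$) of a function $g$ bounded below. For bounded $g:\mathbb{R}^n\to\mathbb{R}$ and $\lambda>0$ let $$C^l_\lambda(g)(x)=\mathrm{co}[\lambda|\cdot|^2+g](x)-\lambda|x|^2,\qquad C^u_\lambda(g)(x)=\lambda|x|^2-\mathrm{co}[\lambda|\cdot|^2-g](x).$$ For $M>0$ let $f_K^{\pm M}$ be equal to $f$ on $K$ and to $\pm M$ on $\mathbb{R}^n\setminus K$, and let $$A^M_\lambda(f_K)(x)=\tfrac12\big(C^l_\lambda(f_K^{M})(x)+C^u_\lambda(f_K^{-M})(x)\big).$$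 For $x\in\Omega_i$ let $d_i(x)=\inf_{|\nu|=1}\big(d^+_\nu(x)+d^-_\nu(x)\big)$, where $d^{\pm}_\nu(x)=\sup\{t>0:\ x\pm s\nu\in\Omega_i\text{ for }0\le s\le t\}$. Let $R>0$ be such that $V_{a_m}\subset B(0;R)$, and let $\tilde f:\mathbb{R}^n\to\mathbb{R}$ be a bounded uniformly continuous function with $\tilde f=f$ on $V_{a_m}$ and $\tilde f=a_m+1$ on $B^c(0;R)$; let $\tilde A_0$ be an upper bound of $|\tilde f|$. Let $\tilde\omega$ be the least concave majorant on $[0,\infty)$ of the modulus of continuity $t\mapsto\sup\{|\tilde f(x)-\tilde f(y)|:|x-y|\le t\}$, and let $\tilde a,\tilde b\ge0$ be such that $\tilde\omega(t)\le\tilde a t+\tilde b$ for all $t\ge0$. **Proposition.** If $\lambda>a_m-a_0+1$ and $M>\tilde A_0+\lambda(2R+1)^2$, then for all $i=0,\dots,m-1$ and all $x\in\Omega_i$, $$|A^M_\lambda(f_K)(x)-f(x)|\le\tilde\omega\Big(d_i(x)+\frac{\tilde a}{\lambda}+\sqrt{\frac{2\tilde b}{\lambda}}\Big).$$ If moreover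 $f$ is globally Lipschitz with constant $L>0$, then under the same conditions on $\lambda$ and $M$, for all $i=0,\dots,m-1$ and all $x\in\Omega_i$, $$|A^M_\lambda(f_K)(x)-f(x)|\le\tilde L\,d_i(x)+\frac{\tilde L^2}{\lambda},$$ where $\tilde L$ is any Lipschitz constant of the restriction of $\tilde f$ to $V_{a_m}\cup B^c(0;R)$; the same holds with $\tilde L=\max\{L,\ \max_{V_{a_m}}|f|+|a_m+1|\}$. -/

import Mathlib

open Set Metric

noncomputable section

namespace LevelSetApprox

/-- `E n` is `ℝⁿ` with the Euclidean norm. -/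
abbrev E (n : ℕ) : Type := EuclideanSpace ℝ (Fin n)

/-- The convex envelope `co[g]`: the largest convex function that is everywhere `≤ g`
(meaningful for `g` bounded below, as is the case wherever it is used). -/
def convexEnvelope {n : ℕ} (g : E n → ℝ) (x : E n) : ℝ :=
  sSup {s : ℝ | ∃ h : E n → ℝ, ConvexOn ℝ univ h ∧ (∀ y, h y ≤ g y) ∧ s = h x}

/-- The quadratic lower compensated convex transform
`C^l_λ(f)(x) = co[λ|·|² + f](x) - λ|x|²`. -/
def lowerTransform {n : ℕ} (lam : ℝ) (f : E n → ℝ) (x : E n) : ℝ :=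
  convexEnvelope (fun y => lam * ‖y‖ ^ 2 + f y) x - lam * ‖x‖ ^ 2

/-- The quadratic upper compensated convex transform
`C^u_λ(f)(x) = λ|x|² - co[λ|·|² - f](x)`. -/
def upperTransform {n : ℕ} (lam : ℝ) (f : E n → ℝ) (x : E n) : ℝ :=
  lam * ‖x‖ ^ 2 - convexEnvelope (fun y => lam * ‖y‖ ^ 2 - f y) x

open Classical in
/-- The function equal to `f` on `K` and to the constant `c` off `K`. It only depends on the
restriction of `f` to `K`; `c = M` gives `f_K^M` and `c = -M` gives `f_K^{-M}`. -/
def extendByConst {n : ℕ} (K : Set (E n)) (f : E n → ℝ) (c : ℝ) (x : E n) : ℝ :=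
  if x ∈ K then f x else c

/-- The average compensated convex approximation `A^M_λ(f_K)`. -/
def averageApprox {n : ℕ} (lam M : ℝ) (K : Set (E n)) (f : E n → ℝ) (x : E n) : ℝ :=
  (lowerTransform lam (extendByConst K f M) x
    + upperTransform lam (extendByConst K f (-M)) x) / 2

/-- The level set `Γ_a = {f = a}`. -/
def levelSet {n : ℕ} (f : E n → ℝ) (a : ℝ) : Set (E n) := {x | f x = a}

/-- The sublevel set `V_a = {f ≤ a}`. -/
def sublevelSet {n : ℕ} (f : E n → ℝ) (a : ℝ) : Set (E n) := {x | f x ≤ a}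

/-- The open strip `{a < f < b}`. -/
def strip {n : ℕ} (f : E n → ℝ) (a b : ℝ) : Set (E n) := {x | a < f x ∧ f x < b}

/-- `d⁺_ν(x) = sup {t > 0 : x + sν ∈ Q for 0 ≤ s ≤ t}`; replacing `ν` by `-ν` gives `d⁻_ν(x)`. -/
def rayLength {n : ℕ} (Q : Set (E n)) (x ν : E n) : ℝ :=
  sSup {t : ℝ | 0 < t ∧ ∀ s : ℝ, 0 ≤ s → s ≤ t → x + s • ν ∈ Q}

/-- `d(x) = inf {d⁺_ν(x) + d⁻_ν(x) : |ν| = 1}`, for `x ∈ Q`. -/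
def directionalWidth {n : ℕ} (Q : Set (E n)) (x : E n) : ℝ :=
  sInf {d : ℝ | ∃ ν : E n, ‖ν‖ = 1 ∧ d = rayLength Q x ν + rayLength Q x (-ν)}

/-- The modulus of continuity `ω_f(t) = sup {|f x - f y| : |x - y| ≤ t}` of a bounded function. -/
def modulus {n : ℕ} (f : E n → ℝ) (t : ℝ) : ℝ :=
  sSup {s : ℝ | ∃ x y : E n, ‖x - y‖ ≤ t ∧ s = |f x - f y|}

/-- The least concave majorant on `[0, ∞)` of a function `[0, ∞) → ℝ`. -/
def leastConcaveMajorant (g : ℝ → ℝ) (t : ℝ) : ℝ :=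
  sInf {s : ℝ | ∃ h : ℝ → ℝ, ConcaveOn ℝ (Ici 0) h ∧ (∀ r, 0 ≤ r → g r ≤ h r) ∧ s = h t}

/-- The function `ω̃`: the least concave majorant of the modulus of continuity of `f`. -/
def concaveModulus {n : ℕ} (f : E n → ℝ) (t : ℝ) : ℝ :=
  leastConcaveMajorant (modulus f) t

end LevelSetApprox

end

/-!
The lower transform of `f_K^M` at `x` is, up to `ε`, the cost `∑ w (f z + λ |z - x|²)` of a convex
combination `x = ∑ w z` (`exists_mem_convexHull_lt`), and `C^u_λ(g) = -C^l_λ(-g)`. If one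
combination with points in `K` could be used for both transforms, the quadratic terms would cancel
in the average, so `A^M_λ(f_K)(x)` would lie above or below the mean value `∑ w f z`. A combination
which is almost optimal for either transform cannot be spread out: comparing its cost with that of
the two end points of a short chord of `Ω_i` through `x` bounds `σ = ∑ w |z - x|` through
`λ σ² ≤ ã σ + ã d / 2 + 2 b̃ + λ d² / 4 + ε`, hence `σ ≤ d + ã / λ + √(2 b̃ / λ)`, and Jensen's
inequality for the concave modulus gives the estimate (`ConvexRep.abs_avg_sub_le`).

The difficulty is that almost optimal combinations may use points off `K`. Inside the ball of
radius `R + 1` the value `M` is so large that such points can be replaced by points of the sphere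
of radius `R + 1` carrying the value `a_m + 1` of the auxiliary function
(`exists_cost_le_lowerTransform_add`), for both transforms. For the upper transform the points at
and beyond that sphere can in turn be pulled back to the level set `Γ_{a_m}`
(`ConvexRep.exists_cost_neg_le`); for the lower transform this can fail, but it is not
needed, since only the upper transform has to be tested with the combination coming from the lower
one. The oscillation of the auxiliary function is used only on `V_{a_m}` and at distance at least
`1` from it, which is why the explicit constant of the Lipschitz case is admissible.
-/

namespace LevelSetApprox

/-! ### Finite convex combinations -/

/-- A representation of `x` as a finite convex combination of points of `S`. -/
structure ConvexRep {n : ℕ} (S : Set (E n)) (x : E n) where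
  /-- The index type. -/
  ι : Type
  [fintype : Fintype ι]
  /-- The weights. -/
  weight : ι → ℝ
  /-- The points. -/
  point : ι → E n
  weight_nonneg : ∀ i, 0 ≤ weight i
  sum_weight : ∑ i, weight i = 1
  point_mem : ∀ i, point i ∈ S
  sum_smul : ∑ i, weight i • point i = x

attribute [instance] ConvexRep.fintype

namespace ConvexRep

variable {n : ℕ} {S : Set (E n)} {x : E n}

/-- The weighted mean of the values of `φ` at the points of the representation. -/
def avg (c : ConvexRep S x) (φ : E n → ℝ) : ℝ := ∑ i, c.weight i * φ (c.point i)

lemma avg_mono (c : ConvexRep S x) {φ ψ : E n → ℝ} (h : ∀ z ∈ S, φ z ≤ ψ z) :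
    c.avg φ ≤ c.avg ψ :=
  Finset.sum_le_sum fun i _ =>
    mul_le_mul_of_nonneg_left (h _ (c.point_mem i)) (c.weight_nonneg i)

lemma avg_congr (c : ConvexRep S x) {φ ψ : E n → ℝ} (h : ∀ z ∈ S, φ z = ψ z) :
    c.avg φ = c.avg ψ :=
  le_antisymm (c.avg_mono fun z hz => (h z hz).le) (c.avg_mono fun z hz => (h z hz).ge)

lemma avg_add (c : ConvexRep S x) (φ ψ : E n → ℝ) :
    c.avg (fun z => φ z + ψ z) = c.avg φ + c.avg ψ := by
  simp [avg, mul_add, Finset.sum_add_distrib]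

lemma avg_neg (c : ConvexRep S x) (φ : E n → ℝ) : c.avg (fun z => -φ z) = -c.avg φ := by
  simp [avg]

lemma avg_const_mul (c : ConvexRep S x) (r : ℝ) (φ : E n → ℝ) :
    c.avg (fun z => r * φ z) = r * c.avg φ := by
  simp only [avg, Finset.mul_sum]
  exact Finset.sum_congr rfl fun i _ => by ring

lemma avg_const (c : ConvexRep S x) (r : ℝ) : c.avg (fun _ => r) = r := by
  simp [avg, ← Finset.sum_mul, c.sum_weight]

lemma avg_inner (c : ConvexRep S x) (v : E n) : c.avg (fun z => inner ℝ z v) = inner ℝ x v := by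
  conv_rhs => rw [← c.sum_smul, sum_inner]
  exact Finset.sum_congr rfl fun i _ => (real_inner_smul_left _ _ _).symm

lemma avg_norm_sub_sq (c : ConvexRep S x) :
    c.avg (fun z => ‖z - x‖ ^ 2) = c.avg (fun z => ‖z‖ ^ 2) - ‖x‖ ^ 2 := by
  have h : (fun z : E n => ‖z - x‖ ^ 2) =
      fun z => ‖z‖ ^ 2 + ((-2) * inner ℝ z x + ‖x‖ ^ 2) := by
    funext z
    rw [norm_sub_sq_real]
    ring
  rw [h, avg_add, avg_add, avg_const_mul, avg_inner, avg_const, real_inner_self_eq_norm_sq]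
  ring

lemma avg_nonneg (c : ConvexRep S x) {φ : E n → ℝ} (h : ∀ z ∈ S, 0 ≤ φ z) : 0 ≤ c.avg φ :=
  Finset.sum_nonneg fun i _ => mul_nonneg (c.weight_nonneg i) (h _ (c.point_mem i))

lemma sq_avg_le (c : ConvexRep S x) (φ : E n → ℝ) : c.avg φ ^ 2 ≤ c.avg (fun z => φ z ^ 2) := by
  have h := (even_two.convexOn_pow (𝕜 := ℝ)).map_sum_le (t := Finset.univ) (w := c.weight)
    (p := fun i => φ (c.point i)) (fun i _ => c.weight_nonneg i) c.sum_weight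
    (fun i _ => mem_univ _)
  simpa [avg] using h

/-- Jensen's inequality for a concave function on `[0, ∞)`. -/
lemma avg_comp_le (c : ConvexRep S x) {W : ℝ → ℝ} (hW : ConcaveOn ℝ (Ici 0) W) {φ : E n → ℝ}
    (hφ : ∀ z, 0 ≤ φ z) : c.avg (fun z => W (φ z)) ≤ W (c.avg φ) := by
  have h := hW.le_map_sum (t := Finset.univ) (w := c.weight)
    (p := fun i => φ (c.point i)) (fun i _ => c.weight_nonneg i) c.sum_weight
    (fun i _ => hφ _)
  simpa [avg] using h

lemma map_le_avg (c : ConvexRep S x) {h : E n → ℝ} (hh : ConvexOn ℝ univ h) : h x ≤ c.avg h := by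
  have := hh.map_sum_le (t := Finset.univ) (w := c.weight) (p := c.point)
    (fun i _ => c.weight_nonneg i) c.sum_weight (fun i _ => mem_univ _)
  simpa [avg, c.sum_smul] using this

/-- The enlargement of the set from which the points are drawn. -/
def mono (c : ConvexRep S x) {T : Set (E n)} (h : S ⊆ T) : ConvexRep T x :=
  { c with point_mem := fun i => h (c.point_mem i) }

lemma avg_mono_set (c : ConvexRep S x) {T : Set (E n)} (h : S ⊆ T) (φ : E n → ℝ) :
    (c.mono h).avg φ = c.avg φ := rfl

end ConvexRep

/-- Two points on a line through `x`, at distances `p` and `q` on opposite sides, with the weights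
that have `x` as their mean. -/
noncomputable def segmentRep {n : ℕ} {S : Set (E n)} {x ν : E n} {p q : ℝ} (hp : 0 < p) (hq : 0 < q)
    (hpS : x + p • ν ∈ S) (hqS : x + q • (-ν) ∈ S) : ConvexRep S x where
  ι := Bool
  weight b := if b then q / (p + q) else p / (p + q)
  point b := if b then x + p • ν else x + q • (-ν)
  weight_nonneg b := by cases b <;> simp <;> positivity
  sum_weight := by simp; field_simp; ring
  point_mem b := by
    cases b
    exacts [hqS, hpS]
  sum_smul := by
    have h : p + q ≠ 0 := by positivity
    simp only [Fintype.sum_bool, if_true, Bool.false_eq_true, if_false]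
    have h1 : p / (p + q) = 1 - q / (p + q) := by field_simp; ring
    have h2 : q / (p + q) * p = (1 - q / (p + q)) * q := by field_simp; ring
    rw [h1, smul_add, smul_add, smul_smul, smul_smul, h2]
    module

lemma avg_segmentRep {n : ℕ} {S : Set (E n)} {x ν : E n} {p q : ℝ} (hp : 0 < p) (hq : 0 < q)
    (hpS : x + p • ν ∈ S) (hqS : x + q • (-ν) ∈ S) (φ : E n → ℝ) :
    (segmentRep hp hq hpS hqS).avg φ =
      q / (p + q) * φ (x + p • ν) + p / (p + q) * φ (x + q • (-ν)) := by
  change ∑ b : Bool, (if b then q / (p + q) else p / (p + q)) *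
    φ (if b then x + p • ν else x + q • (-ν)) = _
  simp

/-! ### The convex envelope as an infimum over convex combinations -/

/-- The part of the epigraph of `g` lying over `S`. -/
def epigraphOn {n : ℕ} (S : Set (E n)) (g : E n → ℝ) : Set (E n × ℝ) :=
  {p | p.1 ∈ S ∧ g p.1 ≤ p.2}

lemma exists_convexRep_of_mem_convexHull {n : ℕ} {S : Set (E n)} {g : E n → ℝ} {x : E n} {r : ℝ}
    (h : (x, r) ∈ convexHull ℝ (epigraphOn S g)) : ∃ c : ConvexRep S x, c.avg g ≤ r := by
  obtain ⟨ι, _, w, z, hw, hw1, hz, hx⟩ := mem_convexHull_iff_exists_fintype.1 h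
  have h1 := congrArg Prod.fst hx
  have h2 := congrArg Prod.snd hx
  rw [Prod.fst_sum] at h1
  rw [Prod.snd_sum] at h2
  refine ⟨⟨ι, w, fun i => (z i).1, hw, hw1, fun i => (hz i).1, h1⟩, ?_⟩
  calc ∑ i, w i * g (z i).1 ≤ ∑ i, w i * (z i).2 :=
        Finset.sum_le_sum fun i _ => mul_le_mul_of_nonneg_left (hz i).2 (hw i)
    _ = r := h2

lemma ConvexRep.mem_convexHull {n : ℕ} {S : Set (E n)} {x : E n} (c : ConvexRep S x) {g : E n → ℝ}
    {r : ℝ} (h : c.avg g ≤ r) : (x, r) ∈ convexHull ℝ (epigraphOn S g) := by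
  -- every height is raised by the slack `r - avg g`
  refine mem_convexHull_of_exists_fintype c.weight
    (fun i => (c.point i, g (c.point i) + (r - c.avg g))) c.weight_nonneg c.sum_weight
    (fun i => ⟨c.point_mem i, by simpa using h⟩) ?_
  refine Prod.ext ?_ ?_
  · rw [Prod.fst_sum]
    exact c.sum_smul
  · rw [Prod.snd_sum]
    have h1 := c.avg_add g (fun _ => r - c.avg g)
    rw [c.avg_const] at h1
    exact h1.trans (by ring)

lemma convexEnvelope_le_avg {n : ℕ} {S : Set (E n)} {g : E n → ℝ} {b : ℝ} (hb : ∀ y, b ≤ g y)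
    {x : E n} (c : ConvexRep S x) : convexEnvelope g x ≤ c.avg g := by
  refine csSup_le ⟨b, fun _ => b, convexOn_const b convex_univ, hb, rfl⟩ ?_
  rintro _ ⟨h, hh, hle, rfl⟩
  exact (c.map_le_avg hh).trans (c.avg_mono fun z _ => hle z)

/-- The lower boundary of the convex hull of the epigraph of `g` is a convex minorant of `g`, so
the convex envelope comes arbitrarily close to the hull. -/
lemma exists_mem_convexHull_lt {n : ℕ} {g : E n → ℝ} {b : ℝ} (hb : ∀ y, b ≤ g y) (x : E n) {ε : ℝ}
    (hε : 0 < ε) :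
    ∃ r < convexEnvelope g x + ε, (x, r) ∈ convexHull ℝ (epigraphOn univ g) := by
  set C := convexHull ℝ (epigraphOn univ g) with hC
  have hCconv : Convex ℝ C := convex_convexHull ℝ _
  have hmem : ∀ y, (y, g y) ∈ C := fun y => subset_convexHull ℝ _ ⟨mem_univ _, le_rfl⟩
  have hlow : ∀ y r, (y, r) ∈ C → b ≤ r := by
    intro y r h
    have hsub : C ⊆ LinearMap.snd ℝ (E n) ℝ ⁻¹' Ici b :=
      convexHull_min (fun p hp => (hb p.1).trans hp.2)
        ((convex_Ici b).linear_preimage (LinearMap.snd ℝ (E n) ℝ))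
    exact hsub h
  have hbdd : ∀ y, BddBelow {r | (y, r) ∈ C} := fun y => ⟨b, fun r hr => hlow y r hr⟩
  have hne : ∀ y, {r | (y, r) ∈ C}.Nonempty := fun y => ⟨g y, hmem y⟩
  let G : E n → ℝ := fun y => sInf {r | (y, r) ∈ C}
  have hG : ConvexOn ℝ univ G := by
    refine ⟨convex_univ, fun y _ z _ α β hα hβ hαβ => ?_⟩
    refine le_of_forall_pos_le_add fun δ hδ => ?_
    obtain ⟨r, hr, hr'⟩ := exists_lt_of_csInf_lt (hne y) (lt_add_of_pos_right (G y) hδ)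
    obtain ⟨s, hs, hs'⟩ := exists_lt_of_csInf_lt (hne z) (lt_add_of_pos_right (G z) hδ)
    have h1 : G (α • y + β • z) ≤ α * r + β * s :=
      csInf_le (hbdd _) (hCconv hr hs hα hβ hαβ)
    have h2 := mul_le_mul_of_nonneg_left hr'.le hα
    have h3 := mul_le_mul_of_nonneg_left hs'.le hβ
    have h4 : α * δ + β * δ = δ := by rw [← add_mul, hαβ, one_mul]
    simp only [smul_eq_mul]
    linarith
  have hGle : ∀ y, G y ≤ g y := fun y => csInf_le (hbdd y) (hmem y)
  have hGx : G x ≤ convexEnvelope g x :=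
    le_csSup ⟨g x, by rintro _ ⟨h, -, hle, rfl⟩; exact hle x⟩ ⟨G, hG, hGle, rfl⟩
  obtain ⟨r, hr, hr'⟩ := exists_lt_of_csInf_lt (hne x)
    (show sInf {r | (x, r) ∈ C} < convexEnvelope g x + ε from hGx.trans_lt (by linarith))
  exact ⟨r, hr', hr⟩

/-! ### The compensated transforms -/

lemma upperTransform_eq_neg {n : ℕ} (lam : ℝ) (f : E n → ℝ) (x : E n) :
    upperTransform lam f x = -lowerTransform lam (fun y => -f y) x := by
  simp [upperTransform, lowerTransform, sub_eq_add_neg]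

lemma extendByConst_neg {n : ℕ} (K : Set (E n)) (f : E n → ℝ) (c : ℝ) :
    (fun y => -extendByConst K f (-c) y) = extendByConst K (fun y => -f y) c := by
  funext y
  unfold extendByConst
  split_ifs <;> simp

lemma averageApprox_eq {n : ℕ} (lam M : ℝ) (K : Set (E n)) (f : E n → ℝ) (x : E n) :
    averageApprox lam M K f x = (lowerTransform lam (extendByConst K f M) x
      - lowerTransform lam (extendByConst K (fun y => -f y) M) x) / 2 := by
  rw [averageApprox, upperTransform_eq_neg, extendByConst_neg, sub_eq_add_neg]

variable {n : ℕ}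

/-- The cost of a representation of `x`. Its infimum over all representations of `x` by points of
the whole space is the lower transform of `φ` at `x`. -/
noncomputable def ConvexRep.cost {S : Set (E n)} {x : E n} (c : ConvexRep S x) (lam : ℝ) (φ : E n → ℝ) : ℝ :=
  c.avg (fun z => φ z + lam * ‖z - x‖ ^ 2)

lemma ConvexRep.cost_eq {S : Set (E n)} {x : E n} (c : ConvexRep S x) (lam : ℝ) (φ : E n → ℝ) :
    c.cost lam φ = c.avg φ + lam * c.avg (fun z => ‖z - x‖ ^ 2) := by
  rw [cost, avg_add, avg_const_mul]

lemma ConvexRep.cost_eq_avg_sub {S : Set (E n)} {x : E n} (c : ConvexRep S x) (lam : ℝ)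
    (φ : E n → ℝ) :
    c.cost lam φ = c.avg (fun z => lam * ‖z‖ ^ 2 + φ z) - lam * ‖x‖ ^ 2 := by
  rw [cost_eq, avg_norm_sub_sq, avg_add, avg_const_mul]
  ring

lemma neg_le_extendByConst {K : Set (E n)} {φ : E n → ℝ} {A M : ℝ} (hφ : ∀ y ∈ K, |φ y| ≤ A)
    (hM : A ≤ M) (hA : 0 ≤ A) (y : E n) : -A ≤ extendByConst K φ M y := by
  unfold extendByConst
  split_ifs with h
  · exact (abs_le.1 (hφ y h)).1
  · linarith

lemma neg_le_quadratic_add {lam A : ℝ} (hlam : 0 ≤ lam) {F : E n → ℝ} (hF : ∀ y, -A ≤ F y)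
    (y : E n) : -A ≤ lam * ‖y‖ ^ 2 + F y := by
  have : 0 ≤ lam * ‖y‖ ^ 2 := by positivity
  linarith [hF y]

lemma lowerTransform_le_cost {K : Set (E n)} {φ : E n → ℝ} {lam A M : ℝ} (hlam : 0 ≤ lam)
    (hφ : ∀ y ∈ K, |φ y| ≤ A) (hM : A ≤ M) (hA : 0 ≤ A) {x : E n} (c : ConvexRep K x) :
    lowerTransform lam (extendByConst K φ M) x ≤ c.cost lam φ := by
  have h := convexEnvelope_le_avg
    (neg_le_quadratic_add hlam (neg_le_extendByConst hφ hM hA)) c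
  have h2 : c.avg (fun y => lam * ‖y‖ ^ 2 + extendByConst K φ M y) =
      c.avg (fun y => lam * ‖y‖ ^ 2 + φ y) :=
    c.avg_congr fun z hz => by simp [extendByConst, hz]
  rw [c.cost_eq_avg_sub, lowerTransform, ← h2]
  linarith

/-- A point of the ball of radius `ρ` off `K`, where the extension has the large value `M`, is a
convex combination of two points of the sphere of radius `ρ`, at which the values of `φ` cost less.
So the lower transform is almost attained on `K` and the complement of the ball. -/
lemma exists_cost_le_lowerTransform_add {K : Set (E n)} {φ : E n → ℝ} {lam A M ρ : ℝ}
    (hlam : 0 ≤ lam) (hφ : ∀ y, |φ y| ≤ A) (hρ : 0 < ρ) (hM : A + lam * ρ ^ 2 ≤ M)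
    {ν : E n} (hν : ‖ν‖ = 1) (x : E n) {ε : ℝ} (hε : 0 < ε) :
    ∃ c : ConvexRep (K ∪ (ball 0 ρ)ᶜ) x,
      c.cost lam φ ≤ lowerTransform lam (extendByConst K φ M) x + ε := by
  have hA : 0 ≤ A := (abs_nonneg _).trans (hφ 0)
  have hAM : A ≤ M := by
    have : 0 ≤ lam * ρ ^ 2 := by positivity
    linarith
  obtain ⟨r, hr, hmem⟩ := exists_mem_convexHull_lt
    (neg_le_quadratic_add hlam
      (neg_le_extendByConst (K := K) (fun y _ => hφ y) hAM hA)) x hε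
  set ψ : E n → ℝ := fun z => lam * ‖z‖ ^ 2 + φ z with hψ
  have key : ∀ (z : E n) (s : ℝ), lam * ‖z‖ ^ 2 + extendByConst K φ M z ≤ s →
      (z, s) ∈ convexHull ℝ (epigraphOn (K ∪ (ball 0 ρ)ᶜ) ψ) := by
    intro z s hs
    by_cases hz : z ∈ K ∪ (ball 0 ρ)ᶜ
    · refine subset_convexHull ℝ _ ⟨hz, le_trans ?_ hs⟩
      have : φ z ≤ extendByConst K φ M z := by
        unfold extendByConst
        split_ifs
        · exact le_rfl
        · exact (abs_le.1 (hφ z)).2.trans hAM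
      simp only [hψ]
      linarith
    · have hzK : z ∉ K := fun h => hz (Or.inl h)
      have hzb : ‖z‖ < ρ := by
        by_contra h
        exact hz (Or.inr (by simpa using h))
      simp only [extendByConst, hzK, if_false] at hs
      -- the line through `z` in the direction `v` meets the sphere on both sides of `z`
      have hsph : ∀ v : E n, ‖v‖ = 1 → ∃ p : ℝ, 0 < p ∧ ‖z + p • v‖ = ρ := by
        intro v hv
        have hcont : ContinuousOn (fun p : ℝ => ‖z + p • v‖) (Icc 0 (2 * ρ)) := by fun_prop
        have h2 : ρ ≤ ‖z + (2 * ρ) • v‖ := by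
          have h := norm_sub_le (z + (2 * ρ) • v) z
          rw [add_sub_cancel_left, norm_smul, hv, Real.norm_of_nonneg (by positivity)] at h
          linarith
        obtain ⟨p, hp, hpe⟩ := intermediate_value_Icc (by positivity : (0 : ℝ) ≤ 2 * ρ) hcont
          (show ρ ∈ Icc _ _ from ⟨by simpa using hzb.le, h2⟩)
        refine ⟨p, lt_of_le_of_ne hp.1 ?_, hpe⟩
        rintro rfl
        simp only [zero_smul, add_zero] at hpe
        exact hzb.ne hpe
      obtain ⟨p, hp, hpρ⟩ := hsph ν hν
      obtain ⟨q, hq, hqρ⟩ := hsph (-ν) (by rwa [norm_neg])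
      have hout : ∀ y : E n, ‖y‖ = ρ → y ∈ sphere (0 : E n) ρ := fun y hy => by simpa using hy
      have hsub : sphere (0 : E n) ρ ⊆ K ∪ (ball 0 ρ)ᶜ := fun y hy => Or.inr (by
        simp only [mem_sphere_zero_iff_norm] at hy
        simp [hy])
      let c : ConvexRep (sphere (0 : E n) ρ) z := segmentRep hp hq (hout _ hpρ) (hout _ hqρ)
      refine (c.mono hsub).mem_convexHull (le_trans ?_ hs)
      rw [c.avg_mono_set]
      calc c.avg ψ ≤ c.avg (fun _ => M) := c.avg_mono fun y hy => by
            simp only [mem_sphere_zero_iff_norm] at hy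
            simp only [hψ, hy]
            linarith [(abs_le.1 (hφ y)).2]
        _ = M := c.avg_const M
        _ ≤ lam * ‖z‖ ^ 2 + M := by
            have : 0 ≤ lam * ‖z‖ ^ 2 := by positivity
            linarith
  have hsub : convexHull ℝ (epigraphOn univ fun y => lam * ‖y‖ ^ 2 + extendByConst K φ M y) ⊆
      convexHull ℝ (epigraphOn (K ∪ (ball 0 ρ)ᶜ) ψ) :=
    convexHull_min (fun p hp => key p.1 p.2 hp.2) (convex_convexHull ℝ _)
  obtain ⟨c, hc⟩ := exists_convexRep_of_mem_convexHull (hsub hmem)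
  refine ⟨c, ?_⟩
  rw [c.cost_eq_avg_sub, lowerTransform]
  linarith

/-! ### Moving points into the union of the level sets -/

/-- If every point of a representation of `x` can be pulled towards `x` into `S`, with the
nonnegative cost `γ` decreasing at least in proportion to the distance, then `x` is represented by
points of `S` at no larger cost. The points `x + (z - x) / τ` get the weights of the points `z`
multiplied by `τ`, and normalized. -/
lemma ConvexRep.exists_pull {S T : Set (E n)} {x : E n} (c : ConvexRep T x) {γ : E n → ℝ}
    (h : ∀ z ∈ T, ∃ τ : ℝ, 1 ≤ τ ∧ x + τ⁻¹ • (z - x) ∈ S ∧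
      τ * γ (x + τ⁻¹ • (z - x)) ≤ γ z ∧ 0 ≤ γ z) :
    ∃ c' : ConvexRep S x, c'.avg γ ≤ c.avg γ := by
  choose τ hτ hS hγ h0 using fun i => h (c.point i) (c.point_mem i)
  set N := ∑ i, c.weight i * τ i with hN
  have hN1 : 1 ≤ N := by
    rw [← c.sum_weight]
    exact Finset.sum_le_sum fun i _ => le_mul_of_one_le_right (c.weight_nonneg i) (hτ i)
  have hN0 : 0 < N := by linarith
  have hcenter : ∑ i, c.weight i • (c.point i - x) = 0 := by
    simp_rw [smul_sub]
    rw [Finset.sum_sub_distrib, c.sum_smul, ← Finset.sum_smul, c.sum_weight, one_smul, sub_self]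
  have hsum : ∑ i, c.weight i * τ i / N = 1 := by
    rw [← Finset.sum_div, ← hN, div_self hN0.ne']
  refine ⟨⟨c.ι, fun i => c.weight i * τ i / N, fun i => x + (τ i)⁻¹ • (c.point i - x),
    fun i => ?_, hsum, hS, ?_⟩, ?_⟩
  · have := hτ i
    have := c.weight_nonneg i
    positivity
  · have hterm : ∀ i, (c.weight i * τ i / N) • (x + (τ i)⁻¹ • (c.point i - x)) =
        (c.weight i * τ i / N) • x + N⁻¹ • (c.weight i • (c.point i - x)) := by
      intro i
      have : τ i ≠ 0 := by linarith [hτ i]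
      rw [smul_add, smul_smul, smul_smul]
      congr 2
      field_simp
    simp_rw [hterm]
    rw [Finset.sum_add_distrib, ← Finset.sum_smul, hsum, ← Finset.smul_sum, hcenter, smul_zero,
      add_zero, one_smul]
  · calc ∑ i, c.weight i * τ i / N * γ (x + (τ i)⁻¹ • (c.point i - x))
        ≤ ∑ i, N⁻¹ * (c.weight i * γ (c.point i)) := by
          refine Finset.sum_le_sum fun i _ => ?_
          have h1 := mul_le_mul_of_nonneg_left (hγ i) (c.weight_nonneg i)
          have h2 := mul_le_mul_of_nonneg_left h1 (inv_nonneg.2 hN0.le)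
          calc _ = N⁻¹ * (c.weight i * (τ i * γ (x + (τ i)⁻¹ • (c.point i - x)))) := by
                rw [div_eq_mul_inv]; ring
            _ ≤ _ := h2
      _ = N⁻¹ * c.avg γ := (Finset.mul_sum _ _ _).symm
      _ ≤ c.avg γ := mul_le_of_le_one_left
          (Finset.sum_nonneg fun i _ => mul_nonneg (c.weight_nonneg i) (h0 i))
          (inv_le_one_of_one_le₀ hN1)

/-- For the upper transform the points at distance at least `1` from a sublevel set `V_α`, where
the auxiliary function equals `α + 1`, are dispensable: pulling such a point towards `x` down to
the level `α` shortens the distance by at least `1`, and the quadratic cost saved outweighs the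
excess `1` of the value. -/
lemma ConvexRep.exists_cost_neg_le {K : Set (E n)} {f g : E n → ℝ} (hf : Continuous f)
    {α R lam : ℝ} (hlam : 1 ≤ lam) (hV : sublevelSet f α ⊆ ball 0 R) (hK : K ⊆ sublevelSet f α)
    (hΓ : levelSet f α ⊆ K) (hgV : ∀ y ∈ sublevelSet f α, g y = f y)
    (hgB : ∀ y ∈ (ball (0 : E n) R)ᶜ, g y = α + 1) {x : E n} (hx : f x < α)
    (c : ConvexRep (K ∪ (ball 0 (R + 1))ᶜ) x) :
    ∃ c' : ConvexRep K x, c'.cost lam (fun y => -g y) ≤ c.cost lam (fun y => -g y) := by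
  -- shifted by `α`, the cost of a point is nonnegative, and on the level `α` purely quadratic
  set γ : E n → ℝ := fun z => α + (-g z + lam * ‖z - x‖ ^ 2) with hγ
  suffices h : ∃ c' : ConvexRep K x, c'.avg γ ≤ c.avg γ by
    obtain ⟨c', hc'⟩ := h
    refine ⟨c', ?_⟩
    have hshift : ∀ {S : Set (E n)} (e : ConvexRep S x),
        e.avg γ = α + e.cost lam (fun y => -g y) := fun e => by
      rw [hγ, avg_add e (fun _ => α), avg_const, cost]
    rw [hshift, hshift] at hc'
    exact le_of_add_le_add_left hc'
  refine c.exists_pull fun z hz => ?_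
  by_cases hzK : z ∈ K
  · refine ⟨1, le_rfl, by simpa using hzK, by simp, ?_⟩
    have h1 : f z ≤ α := hK hzK
    have h2 : 0 ≤ lam * ‖z - x‖ ^ 2 := by positivity
    simp only [hγ, hgV z (hK hzK)]
    linarith
  · have hzR : R + 1 ≤ ‖z‖ := by
      have := hz.resolve_left hzK
      simpa using this
    have hzB : z ∈ (ball (0 : E n) R)ᶜ := by
      simp only [mem_compl_iff, mem_ball_zero_iff, not_lt]
      linarith
    have hfz : α < f z := by
      by_contra h
      exact hzB (hV (not_lt.1 h))
    have hcont : ContinuousOn (fun s : ℝ => f (x + s • (z - x))) (Icc 0 1) := by fun_prop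
    obtain ⟨s, hs, hsα⟩ := intermediate_value_Icc zero_le_one hcont
      (show α ∈ Icc _ _ from ⟨by simpa using hx.le, by simpa using hfz.le⟩)
    have hs0 : 0 < s := by
      refine lt_of_le_of_ne hs.1 ?_
      rintro rfl
      simp only [zero_smul, add_zero] at hsα
      exact hx.ne hsα
    set y := x + s • (z - x) with hy
    have hyV : y ∈ sublevelSet f α := le_of_eq hsα
    have hyR : ‖y‖ < R := by simpa using hV hyV
    have hxR : ‖x‖ < R := by simpa using hV (show x ∈ sublevelSet f α from hx.le)
    set D := ‖z - x‖ with hD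
    have hD1 : 1 ≤ D := by
      have := norm_sub_norm_le z x
      linarith
    have hyx : ‖y - x‖ = s * D := by
      rw [hy, add_sub_cancel_left, norm_smul, Real.norm_of_nonneg hs0.le]
    have hzy : 1 ≤ (1 - s) * D := by
      have h1 : z - y = (1 - s) • (z - x) := by rw [hy]; module
      have h2 := norm_sub_norm_le z y
      rw [h1, norm_smul, Real.norm_of_nonneg (by linarith [hs.2])] at h2
      linarith
    have hgain : 1 ≤ (1 - s) * D * (lam * D) :=
      one_le_mul_of_one_le_of_one_le hzy (one_le_mul_of_one_le_of_one_le hlam hD1)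
    refine ⟨s⁻¹, (one_le_inv₀ hs0).2 hs.2, ?_, ?_, ?_⟩
    · rw [inv_inv]
      exact hΓ hsα
    · rw [inv_inv]
      simp only [hγ, ← hy, hyx, hgV y hyV, hgB z hzB, ← hD, show f y = α from hsα]
      have : s⁻¹ * (α + (-α + lam * (s * D) ^ 2)) = lam * s * D ^ 2 := by
        field_simp
        ring
      rw [this]
      nlinarith [hgain]
    · simp only [hγ, hgB z hzB, ← hD]
      nlinarith [one_le_mul_of_one_le_of_one_le hD1 (one_le_mul_of_one_le_of_one_le hlam hD1)]

/-! ### Ray lengths in a bounded open strip -/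

/-- In a bounded open set `Q` the ray from `x ∈ Q` leaves `Q` at a boundary point. -/
lemma rayLength_exit {Q : Set (E n)} (hQ : IsOpen Q) {x : E n} (hx : x ∈ Q) {ρ : ℝ}
    (hball : Q ⊆ ball 0 ρ) {r : ℝ} (hr : 0 < r) (hrQ : ball x r ⊆ Q) {ν : E n} (hν : ‖ν‖ = 1) :
    r ≤ rayLength Q x ν ∧ x + rayLength Q x ν • ν ∉ Q ∧
      x + rayLength Q x ν • ν ∈ closure Q := by
  set A := {t : ℝ | 0 < t ∧ ∀ s : ℝ, 0 ≤ s → s ≤ t → x + s • ν ∈ Q} with hA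
  set d := rayLength Q x ν with hd
  have hdA : d = sSup A := rfl
  have hbdd : BddAbove A := by
    refine ⟨2 * ρ, fun t ht => ?_⟩
    have h1 : ‖x + t • ν‖ < ρ := by simpa using hball (ht.2 t ht.1.le le_rfl)
    have h2 : ‖x‖ < ρ := by simpa using hball hx
    have h3 := norm_sub_le (x + t • ν) x
    rw [add_sub_cancel_left, norm_smul, hν, Real.norm_of_nonneg ht.1.le] at h3
    linarith
  have hsmall : ∀ t, 0 < t → t < r → t ∈ A := fun t ht htr => ⟨ht, fun s hs hst => hrQ (by
    rw [mem_ball_iff_norm, add_sub_cancel_left, norm_smul, hν, Real.norm_of_nonneg hs]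
    linarith)⟩
  have hrd : r ≤ d := by
    refine le_of_forall_lt fun t ht => ?_
    have h1 : max t 0 < r := max_lt ht hr
    have h2 : (max t 0 + r) / 2 ∈ A := hsmall _ (by linarith [le_max_right t 0]) (by linarith)
    have h3 : (max t 0 + r) / 2 ≤ d := le_csSup hbdd h2
    linarith [le_max_left t 0]
  have hne : A.Nonempty := ⟨r / 2, hsmall _ (by linarith) (by linarith)⟩
  have hin : ∀ s, 0 ≤ s → s < d → x + s • ν ∈ Q := by
    intro s hs hsd
    obtain ⟨t, ht, hst⟩ := exists_lt_of_lt_csSup hne (hdA ▸ hsd)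
    exact ht.2 s hs hst.le
  have hcont : Continuous fun s : ℝ => x + s • ν := by fun_prop
  have hd0 : 0 < d := hr.trans_le hrd
  refine ⟨hrd, fun hmem => ?_, ?_⟩
  · obtain ⟨δ, hδ, hδQ⟩ := Metric.isOpen_iff.1 (hQ.preimage hcont) d hmem
    have h1 : d + δ / 2 ∈ A := by
      refine ⟨by linarith, fun s hs hst => ?_⟩
      rcases lt_or_ge s d with h | h
      · exact hin s hs h
      · exact hδQ (by rw [mem_ball, Real.dist_eq, abs_lt]; constructor <;> linarith)
    have := le_csSup hbdd h1
    linarith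
  · have h1 : d ∈ closure (Ico 0 d) := by
      rw [closure_Ico hd0.ne]
      exact ⟨hd0.le, le_rfl⟩
    exact map_mem_closure (f := fun s : ℝ => x + s • ν) hcont h1 fun s hs => hin s hs.1 hs.2

lemma isOpen_strip {f : E n → ℝ} (hf : Continuous f) (α β : ℝ) : IsOpen (strip f α β) :=
  (isOpen_lt continuous_const hf).inter (isOpen_lt hf continuous_const)

lemma mem_levelSet_of_mem_closure_strip {f : E n → ℝ} (hf : Continuous f) {α β : ℝ} {y : E n}
    (hy : y ∈ closure (strip f α β)) (hy' : y ∉ strip f α β) :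
    y ∈ levelSet f α ∪ levelSet f β := by
  have h1 : closure (strip f α β) ⊆ {y | α ≤ f y ∧ f y ≤ β} :=
    closure_minimal (fun z hz => ⟨hz.1.le, hz.2.le⟩)
      ((isClosed_le continuous_const hf).inter (isClosed_le hf continuous_const))
  obtain ⟨h2, h3⟩ := h1 hy
  rcases h2.eq_or_lt with h | h
  · exact Or.inl h.symm
  · rcases h3.eq_or_lt with h' | h'
    · exact Or.inr h'
    · exact absurd ⟨h, h'⟩ hy'

/-- The directional width at a point of a bounded strip is positive, and lines through the point
cross the strip in a length arbitrarily close to it. -/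
lemma exists_chord {f : E n → ℝ} (hf : Continuous f) {α β : ℝ} {x : E n}
    (hx : x ∈ strip f α β) {ρ : ℝ} (hball : strip f α β ⊆ ball 0 ρ) {ν₀ : E n} (hν₀ : ‖ν₀‖ = 1) :
    0 < directionalWidth (strip f α β) x ∧
      ∀ D, directionalWidth (strip f α β) x < D → ∃ (ν : E n) (p q : ℝ), ‖ν‖ = 1 ∧ 0 < p ∧ 0 < q ∧
        p + q < D ∧ x + p • ν ∈ levelSet f α ∪ levelSet f β ∧
        x + q • (-ν) ∈ levelSet f α ∪ levelSet f β := by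
  obtain ⟨r, hr, hrQ⟩ := Metric.isOpen_iff.1 (isOpen_strip hf α β) x hx
  have hexit : ∀ ν : E n, ‖ν‖ = 1 → r ≤ rayLength (strip f α β) x ν ∧
      x + rayLength (strip f α β) x ν • ν ∈ levelSet f α ∪ levelSet f β := by
    intro ν hν
    obtain ⟨h1, h2, h3⟩ := rayLength_exit (isOpen_strip hf α β) hx hball hr hrQ hν
    exact ⟨h1, mem_levelSet_of_mem_closure_strip hf h3 h2⟩
  have hne : {d : ℝ | ∃ ν : E n, ‖ν‖ = 1 ∧ d = rayLength (strip f α β) x ν +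
      rayLength (strip f α β) x (-ν)}.Nonempty := ⟨_, ν₀, hν₀, rfl⟩
  refine ⟨?_, fun D hD => ?_⟩
  · refine lt_of_lt_of_le hr (le_csInf hne ?_)
    rintro _ ⟨ν, hν, rfl⟩
    linarith [(hexit ν hν).1, (hexit (-ν) (by rwa [norm_neg])).1]
  · obtain ⟨_, ⟨ν, hν, rfl⟩, hlt⟩ := exists_lt_of_csInf_lt hne hD
    have h1 := hexit ν hν
    have h2 := hexit (-ν) (by rwa [norm_neg])
    exact ⟨ν, _, _, hν, hr.trans_le h1.1, hr.trans_le h2.1, hlt, h1.2, h2.2⟩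

/-! ### Spread of almost optimal representations -/

/-- The quadratic inequality satisfied by the spread `σ` of an almost optimal representation. The
slack `3 d² / 4` leaves room for chords a little longer than `d` and for the error `ε`. -/
lemma le_of_quadratic_bound {lam a b d δ ε σ : ℝ} (hlam : 0 < lam) (ha : 0 ≤ a) (hb : 0 ≤ b)
    (hd : 0 < d) (hδ0 : 0 ≤ δ) (hδ : δ ≤ 3 / 2 * d) (hε : ε ≤ lam * d ^ 2 / 4)
    (h : lam * σ ^ 2 ≤ a * σ + a * δ / 2 + 2 * b + lam * δ ^ 2 / 4 + ε) :
    σ ≤ d + a / lam + Real.sqrt (2 * b / lam) := by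
  set q := Real.sqrt (2 * b / lam) with hq
  have hq0 : 0 ≤ q := Real.sqrt_nonneg _
  have hq2 : lam * q ^ 2 = 2 * b := by
    rw [hq, Real.sq_sqrt (by positivity)]
    field_simp
  set e := a / lam with he
  have hae : a = lam * e := by rw [he]; field_simp
  have he0 : 0 ≤ e := by positivity
  by_contra! hlt
  have hδ2 : δ ^ 2 ≤ 9 / 4 * d ^ 2 := by nlinarith
  have h1 : (d + e + q) * (d + q) < σ * (σ - e) := by
    apply mul_lt_mul'' hlt <;> linarith
  have h2 : lam * (σ * (σ - e)) ≤ lam * (e * δ / 2 + q ^ 2 + d ^ 2 * (13 / 16)) := by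
    rw [hae] at h
    nlinarith
  have h3 := le_of_mul_le_mul_left h2 hlam
  have h4 : e * δ ≤ e * (3 / 2 * d) := mul_le_mul_of_nonneg_left hδ he0
  nlinarith [mul_nonneg he0 hd.le, mul_nonneg hq0 hd.le, mul_nonneg he0 hq0, sq_nonneg d,
    mul_pos hd hd]

/-- The main estimate. A representation of `x` whose cost exceeds that of a short chord through
`x` by little has its points at mean distance at most `d + a / λ + √(2 b / λ)` from `x`, hence
its mean value is close to the value at `x`. -/
lemma ConvexRep.abs_avg_sub_le {T : Set (E n)} {φ : E n → ℝ} {W : ℝ → ℝ}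
    (hW : ConcaveOn ℝ (Ici 0) W) (hWm : MonotoneOn W (Ici 0)) {lam a b : ℝ} (hlam : 0 < lam)
    (ha : 0 ≤ a) (hb : 0 ≤ b) (hWab : ∀ t, 0 ≤ t → W t ≤ a * t + b) {x : E n}
    (hφ : ∀ u ∈ T, |φ u - φ x| ≤ W ‖u - x‖) (c : ConvexRep T x)
    {ν : E n} (hν : ‖ν‖ = 1) {p q d ε : ℝ} (hp : 0 < p) (hq : 0 < q) (hd : 0 < d)
    (hpq : p + q ≤ 3 / 2 * d) (hpT : x + p • ν ∈ T) (hqT : x + q • (-ν) ∈ T)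
    (hε : ε ≤ lam * d ^ 2 / 4)
    (hc : c.cost lam φ ≤ (segmentRep hp hq hpT hqT).cost lam φ + ε) :
    |c.avg φ - φ x| ≤ W (d + a / lam + Real.sqrt (2 * b / lam)) := by
  have habs : ∀ c' : ConvexRep T x, |c'.avg φ - φ x| ≤ W (c'.avg fun z => ‖z - x‖) := by
    intro c'
    have hJ := c'.avg_comp_le hW (φ := fun z => ‖z - x‖) fun z => norm_nonneg _
    have hu : c'.avg (fun z => φ z + -φ x) ≤ c'.avg (fun z => W ‖z - x‖) :=
      c'.avg_mono fun z hz => by linarith [(abs_le.1 (hφ z hz)).2]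
    have hl : c'.avg (fun z => φ x + -φ z) ≤ c'.avg (fun z => W ‖z - x‖) :=
      c'.avg_mono fun z hz => by linarith [(abs_le.1 (hφ z hz)).1]
    rw [avg_add, avg_const] at hu hl
    rw [avg_neg] at hl
    rw [abs_le]
    constructor <;> linarith
  set σ := c.avg fun z => ‖z - x‖ with hσ
  have hσ0 : 0 ≤ σ := c.avg_nonneg fun z _ => norm_nonneg _
  suffices hle : σ ≤ d + a / lam + Real.sqrt (2 * b / lam) from
    (habs c).trans (hWm hσ0 (le_trans hσ0 hle) hle)
  set s := segmentRep hp hq hpT hqT with hs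
  have hnp : ‖x + p • ν - x‖ = p := by
    rw [add_sub_cancel_left, norm_smul, hν, Real.norm_of_nonneg hp.le, mul_one]
  have hnq : ‖x + q • (-ν) - x‖ = q := by
    rw [add_sub_cancel_left, norm_smul, norm_neg, hν, Real.norm_of_nonneg hq.le, mul_one]
  have hpq0 : 0 < p + q := by positivity
  have hs1 : s.avg (fun z => ‖z - x‖) ≤ (p + q) / 2 := by
    rw [hs, avg_segmentRep, hnp, hnq]
    have : q / (p + q) * p + p / (p + q) * q = 2 * (p * q) / (p + q) := by ring
    rw [this, div_le_div_iff₀ hpq0 two_pos]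
    nlinarith [sq_nonneg (p - q)]
  have hs2 : s.avg (fun z => ‖z - x‖ ^ 2) ≤ (p + q) ^ 2 / 4 := by
    rw [hs, avg_segmentRep, hnp, hnq]
    have : q / (p + q) * p ^ 2 + p / (p + q) * q ^ 2 = p * q := by
      field_simp
    rw [this]
    nlinarith [sq_nonneg (p - q)]
  have hs0 : 0 ≤ s.avg (fun z => ‖z - x‖) := s.avg_nonneg fun z _ => norm_nonneg _
  rw [cost_eq, cost_eq] at hc
  have h1 := (abs_le.1 (habs s)).2.trans (hWab _ hs0)
  have h2 := (abs_le.1 (habs c)).1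
  have h3 := hWab σ hσ0
  have h4 := mul_le_mul_of_nonneg_left (c.sq_avg_le fun z => ‖z - x‖) hlam.le
  have h5 := mul_le_mul_of_nonneg_left hs2 hlam.le
  have h6 := mul_le_mul_of_nonneg_left hs1 ha
  refine le_of_quadratic_bound hlam ha hb hd hpq0.le hpq hε ?_
  rw [← hσ] at h4 h2
  linarith

/-! ### The concave modulus of continuity -/

/-- A nonnegative concave function on `[0, ∞)` is nondecreasing, since a decreasing one would
become negative far out. -/
lemma monotoneOn_of_concaveOn_of_nonneg {W : ℝ → ℝ} (hW : ConcaveOn ℝ (Ici 0) W)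
    (h0 : ∀ t, 0 ≤ t → 0 ≤ W t) : MonotoneOn W (Ici 0) := by
  intro s hs t ht hst
  rcases hst.eq_or_lt with rfl | hst
  · exact le_rfl
  by_contra! hlt
  have hs0 : (0 : ℝ) ≤ s := hs
  have hWs : 0 < W s := (h0 t ht).trans_lt hlt
  -- `t` lies between `s` and a far point at which only the sign of `W` matters
  set θ := (W s - W t) / (2 * W s) with hθ
  have hθ0 : 0 < θ := div_pos (by linarith) (by linarith)
  have hθ1 : θ ≤ 1 := by
    rw [hθ, div_le_one (by linarith)]
    linarith [h0 t ht]
  have hr : 0 ≤ s + (t - s) / θ := add_nonneg hs0 (div_nonneg (by linarith) hθ0.le)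
  have h := hW.2 hs (show s + (t - s) / θ ∈ Ici (0 : ℝ) from hr) (by linarith : 0 ≤ 1 - θ) hθ0.le
    (by ring)
  have harg : (1 - θ) • s + θ • (s + (t - s) / θ) = t := by
    simp only [smul_eq_mul]
    field_simp
    ring
  rw [harg] at h
  simp only [smul_eq_mul] at h
  have h2 : θ * W s = (W s - W t) / 2 := by
    rw [hθ]
    field_simp
  have h3 := mul_nonneg hθ0.le (h0 _ hr)
  nlinarith

lemma abs_sub_le_two_mul {g : E n → ℝ} {A : ℝ} (hA : ∀ x, |g x| ≤ A) (x y : E n) :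
    |g x - g y| ≤ 2 * A := by
  linarith [abs_sub (g x) (g y), hA x, hA y]

lemma abs_sub_le_modulus {g : E n → ℝ} {A : ℝ} (hA : ∀ x, |g x| ≤ A) {x y : E n} {t : ℝ}
    (h : ‖x - y‖ ≤ t) : |g x - g y| ≤ modulus g t :=
  le_csSup ⟨2 * A, by rintro _ ⟨u, v, -, rfl⟩; exact abs_sub_le_two_mul hA u v⟩ ⟨x, y, h, rfl⟩

lemma modulus_nonneg (g : E n → ℝ) (t : ℝ) : 0 ≤ modulus g t :=
  Real.sSup_nonneg (by rintro _ ⟨u, v, -, rfl⟩; exact abs_nonneg _)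

lemma modulus_le {g : E n → ℝ} {A : ℝ} (hA : ∀ x, |g x| ≤ A) (t : ℝ) : modulus g t ≤ 2 * A :=
  Real.sSup_le (by rintro _ ⟨u, v, -, rfl⟩; exact abs_sub_le_two_mul hA u v)
    (by linarith [(abs_nonneg _).trans (hA 0)])

section LeastConcaveMajorant

variable {g : ℝ → ℝ}

lemma le_leastConcaveMajorant {B : ℝ} (hB : ∀ t, g t ≤ B) {t : ℝ} (ht : 0 ≤ t) :
    g t ≤ leastConcaveMajorant g t :=
  le_csInf ⟨B, fun _ => B, concaveOn_const B (convex_Ici 0), fun r _ => hB r, rfl⟩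
    (by rintro _ ⟨h, -, hle, rfl⟩; exact hle t ht)

lemma concaveOn_leastConcaveMajorant {B : ℝ} (hB : ∀ t, g t ≤ B) :
    ConcaveOn ℝ (Ici 0) (leastConcaveMajorant g) := by
  refine ⟨convex_Ici 0, fun s hs t ht α β hα hβ hαβ => ?_⟩
  refine le_csInf ⟨B, fun _ => B, concaveOn_const B (convex_Ici 0), fun r _ => hB r, rfl⟩ ?_
  rintro _ ⟨h, hh, hle, rfl⟩
  have hinf : ∀ r ∈ Ici (0 : ℝ), leastConcaveMajorant g r ≤ h r := fun r hr =>
    csInf_le ⟨g r, by rintro _ ⟨k, -, hk, rfl⟩; exact hk r hr⟩ ⟨h, hh, hle, rfl⟩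
  calc _ ≤ α • h s + β • h t := by
        simp only [smul_eq_mul]
        exact add_le_add (mul_le_mul_of_nonneg_left (hinf s hs) hα)
          (mul_le_mul_of_nonneg_left (hinf t ht) hβ)
    _ ≤ _ := hh.2 hs ht hα hβ hαβ

end LeastConcaveMajorant

/-! ### The approximation error -/

lemma extendByConst_congr {K : Set (E n)} {f g : E n → ℝ} (h : ∀ y ∈ K, f y = g y) (c : ℝ) :
    extendByConst K f c = extendByConst K g c := by
  funext y
  unfold extendByConst
  split_ifs with hy
  · exact h y hy
  · rfl

/-- The error estimate for an arbitrary concave nondecreasing function `W` of at most affine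
growth which bounds the oscillation of the auxiliary function `g` on `V_α` and away from it. -/
theorem abs_averageApprox_sub_le {f g : E n → ℝ} (hf : Continuous f) {K : Set (E n)}
    {α β β' R A lam M : ℝ} (hR : 0 < R) (hlam : 1 ≤ lam)
    (hV : sublevelSet f α ⊆ ball 0 R) (hK : K ⊆ sublevelSet f α) (hΓ : levelSet f α ⊆ K)
    (hβ : levelSet f β ∪ levelSet f β' ⊆ K) (hβ'α : β' ≤ α)
    (hgV : ∀ y ∈ sublevelSet f α, g y = f y) (hgB : ∀ y ∈ (ball (0 : E n) R)ᶜ, g y = α + 1)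
    (hA : ∀ y, |g y| ≤ A) (hM : A + lam * (2 * R + 1) ^ 2 ≤ M)
    {W : ℝ → ℝ} (hW : ConcaveOn ℝ (Ici 0) W) (hWm : MonotoneOn W (Ici 0))
    {a b : ℝ} (ha : 0 ≤ a) (hb : 0 ≤ b) (hWab : ∀ t, 0 ≤ t → W t ≤ a * t + b)
    (hg : ∀ u ∈ sublevelSet f α ∪ (ball 0 (R + 1))ᶜ, ∀ v ∈ sublevelSet f α,
      |g u - g v| ≤ W ‖u - v‖)
    {x ν₀ : E n} (hx : x ∈ strip f β β') (hν₀ : ‖ν₀‖ = 1) :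
    |averageApprox lam M K f x - f x| ≤
      W (directionalWidth (strip f β β') x + a / lam + Real.sqrt (2 * b / lam)) := by
  have hlam0 : 0 < lam := by linarith
  have hxα : f x < α := hx.2.trans_le hβ'α
  have hxV : x ∈ sublevelSet f α := hxα.le
  have hball : strip f β β' ⊆ ball 0 R := fun y hy => hV (hy.2.le.trans hβ'α)
  have hAM : A + lam * (R + 1) ^ 2 ≤ M := by
    have : lam * (R + 1) ^ 2 ≤ lam * (2 * R + 1) ^ 2 := by gcongr; linarith
    linarith
  have hA0 : 0 ≤ A := (abs_nonneg _).trans (hA 0)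
  have hAM' : A ≤ M := by
    have : 0 ≤ lam * (R + 1) ^ 2 := by positivity
    linarith
  have hAneg : ∀ y, |(fun y => -g y) y| ≤ A := fun y => by simpa using hA y
  rw [averageApprox_eq, extendByConst_congr (fun y hy => (hgV y (hK hy)).symm) M,
    extendByConst_congr (f := fun y => -f y) (g := fun y => -g y)
      (fun y hy => by rw [hgV y (hK hy)]) M, ← hgV x hxV]
  obtain ⟨hd, hchord⟩ := exists_chord hf hx hball hν₀
  set d := directionalWidth (strip f β β') x with hd_def
  obtain ⟨ν, p, q, hν, hp, hq, hpq, hpΓ, hqΓ⟩ := hchord (3 / 2 * d) (by linarith)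
  have hpK := hβ hpΓ
  have hqK := hβ hqΓ
  have hKT : K ⊆ K ∪ (ball 0 (R + 1))ᶜ := subset_union_left
  have hmain : ∀ φ : E n → ℝ, (∀ y, |φ y| ≤ A) →
      (∀ u ∈ K ∪ (ball 0 (R + 1))ᶜ, |φ u - φ x| ≤ W ‖u - x‖) →
      ∀ c : ConvexRep (K ∪ (ball 0 (R + 1))ᶜ) x, ∀ ε ≤ lam * d ^ 2 / 4,
      c.cost lam φ ≤ lowerTransform lam (extendByConst K φ M) x + ε →
      |c.avg φ - φ x| ≤ W (d + a / lam + Real.sqrt (2 * b / lam)) := by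
    intro φ hφA hφ c ε hε hc
    refine c.abs_avg_sub_le hW hWm hlam0 ha hb hWab hφ hν hp hq hd hpq.le (hKT hpK) (hKT hqK) hε ?_
    have h : lowerTransform lam (extendByConst K φ M) x ≤
        (segmentRep hp hq (hKT hpK) (hKT hqK)).cost lam φ :=
      lowerTransform_le_cost hlam0.le (fun y _ => hφA y) hAM' hA0 (segmentRep hp hq hpK hqK)
    linarith
  have hgx : ∀ u ∈ K ∪ (ball 0 (R + 1))ᶜ, |g u - g x| ≤ W ‖u - x‖ := fun u hu =>
    hg u (hu.imp_left fun h => hK h) x hxV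
  have hgx' : ∀ u ∈ K ∪ (ball 0 (R + 1))ᶜ,
      |(fun y => -g y) u - (fun y => -g y) x| ≤ W ‖u - x‖ := fun u hu => by
    have : -g u - -g x = -(g u - g x) := by ring
    simpa only [this, abs_neg] using hgx u hu
  refine le_of_forall_pos_le_add fun ε hε => ?_
  set η := min ε (lam * d ^ 2 / 4) with hη
  have hη0 : 0 < η := lt_min hε (by positivity)
  obtain ⟨c₁, hc₁⟩ := exists_cost_le_lowerTransform_add (K := K) hlam0.le hA
    (by linarith : 0 < R + 1) hAM hν₀ x hη0
  obtain ⟨c₂, hc₂⟩ := exists_cost_le_lowerTransform_add (K := K) hlam0.le hAneg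
    (by linarith : 0 < R + 1) hAM hν₀ x hη0
  obtain ⟨c₁', hc₁'⟩ := c₁.exists_cost_neg_le hf hlam hV hK hΓ hgV hgB hxα
  obtain ⟨c₂', hc₂'⟩ := c₂.exists_cost_neg_le hf hlam hV hK hΓ hgV hgB hxα
  -- testing both transforms with the same representation cancels the quadratic terms
  have hlow := hmain g hA hgx c₁ η (min_le_right _ _) hc₁
  have hupp := hmain _ hAneg hgx' (c₂'.mono hKT) η (min_le_right _ _) (hc₂'.trans hc₂)
  have h₁ := lowerTransform_le_cost hlam0.le (fun y _ => hAneg y) hAM' hA0 c₁'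
  have h₂ := lowerTransform_le_cost hlam0.le (fun y _ => hA y) hAM' hA0 c₂'
  rw [ConvexRep.cost_eq] at hc₁ h₂
  have h₃ := hc₂'.trans hc₂
  have h₄ := h₁.trans hc₁'
  rw [ConvexRep.cost_eq, ConvexRep.avg_neg] at h₃ h₄
  rw [ConvexRep.avg_mono_set, ConvexRep.avg_neg] at hupp
  have hηε : η ≤ ε := min_le_left _ _
  have := (abs_le.1 hlow).1
  have := (abs_le.1 hupp).1
  rw [abs_le]
  constructor <;> linarith

end LevelSetApprox

open LevelSetApprox

theorem proposition3p3 {n m : ℕ}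
    (f : LevelSetApprox.E n → ℝ) (hf : Continuous f)
    (a : Fin (m + 1) → ℝ) (ha : StrictMono a)
    (hVne : ∀ j, (LevelSetApprox.sublevelSet f (a j)).Nonempty)
    (hVc : ∀ j, IsCompact (LevelSetApprox.sublevelSet f (a j)))
    (K : Set (LevelSetApprox.E n)) (hK : K = ⋃ j, LevelSetApprox.levelSet f (a j))
    -- the ball `B(0; R)` containing the largest sublevel set
    (R : ℝ) (hR : 0 < R)
    (hVR : LevelSetApprox.sublevelSet f (a (Fin.last m)) ⊆ Metric.ball 0 R)
    -- the bounded uniformly continuous extension of the auxiliary function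
    (f' : LevelSetApprox.E n → ℝ) (hf' : UniformContinuous f')
    (hf'V : ∀ x ∈ LevelSetApprox.sublevelSet f (a (Fin.last m)), f' x = f x)
    (hf'B : ∀ x ∈ (Metric.ball (0 : LevelSetApprox.E n) R)ᶜ, f' x = a (Fin.last m) + 1)
    (A₀ : ℝ) (hA₀ : ∀ x, |f' x| ≤ A₀)
    (lam M : ℝ) (hlam : a (Fin.last m) - a 0 + 1 < lam)
    (hM : A₀ + lam * (2 * R + 1) ^ 2 < M) :
    -- the estimate by the modulus of continuity
    (∀ a' b' : ℝ, 0 ≤ a' → 0 ≤ b' →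
      (∀ t : ℝ, 0 ≤ t → LevelSetApprox.concaveModulus f' t ≤ a' * t + b') →
      ∀ i : Fin m, ∀ x ∈ LevelSetApprox.strip f (a i.castSucc) (a i.succ),
        |LevelSetApprox.averageApprox lam M K f x - f x| ≤
          LevelSetApprox.concaveModulus f'
            (LevelSetApprox.directionalWidth
                (LevelSetApprox.strip f (a i.castSucc) (a i.succ)) x
              + a' / lam + Real.sqrt (2 * b' / lam))) ∧
    -- the Lipschitz case: the constant may be any Lipschitz constant of the auxiliary
    -- function, and may also be the explicit maximum
    (∀ L : NNReal, 0 < L → LipschitzWith L f →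
      ∀ L' : NNReal,
        (LipschitzOnWith L' f'
            (LevelSetApprox.sublevelSet f (a (Fin.last m)) ∪ (Metric.ball 0 R)ᶜ) ∨
          (L' : ℝ) = max (L : ℝ)
            (sSup ((fun y => |f y|) '' LevelSetApprox.sublevelSet f (a (Fin.last m)))
              + |a (Fin.last m) + 1|)) →
      ∀ i : Fin m, ∀ x ∈ LevelSetApprox.strip f (a i.castSucc) (a i.succ),
        |LevelSetApprox.averageApprox lam M K f x - f x| ≤
          L' * LevelSetApprox.directionalWidth
              (LevelSetApprox.strip f (a i.castSucc) (a i.succ)) x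
            + (L' : ℝ) ^ 2 / lam) := by
  have hmono := ha.monotone
  set α := a (Fin.last m) with hα
  have hlam1 : 1 ≤ lam := by
    have : a 0 ≤ α := hmono (Fin.zero_le _)
    linarith
  have hKV : K ⊆ sublevelSet f α := by
    rw [hK]
    refine iUnion_subset fun j y hy => ?_
    exact (show f y = a j from hy).le.trans (hmono (Fin.le_last j))
  have hΓ : ∀ j, levelSet f (a j) ⊆ K := fun j => by
    rw [hK]
    exact subset_iUnion (fun j => levelSet f (a j)) j
  -- `x` differs from the points of `V_{a_0}`, so the dimension is positive
  have hdir : ∀ i : Fin m, ∀ x ∈ strip f (a i.castSucc) (a i.succ), ∃ ν : E n, ‖ν‖ = 1 := by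
    intro i x hx
    obtain ⟨v, hv⟩ := hVne 0
    have hne : x - v ≠ 0 := by
      intro h
      rw [sub_eq_zero.1 h] at hx
      exact absurd (hx.1.trans_le hv) (hmono (Fin.zero_le _)).not_gt
    exact ⟨‖x - v‖⁻¹ • (x - v), norm_smul_inv_norm hne⟩
  have hbound : ∀ (W : ℝ → ℝ), ConcaveOn ℝ (Ici 0) W → MonotoneOn W (Ici 0) →
      ∀ a' b' : ℝ, 0 ≤ a' → 0 ≤ b' → (∀ t, 0 ≤ t → W t ≤ a' * t + b') →
      (∀ u ∈ sublevelSet f α ∪ (ball 0 (R + 1))ᶜ, ∀ v ∈ sublevelSet f α,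
        |f' u - f' v| ≤ W ‖u - v‖) →
      ∀ i : Fin m, ∀ x ∈ strip f (a i.castSucc) (a i.succ),
        |averageApprox lam M K f x - f x| ≤
          W (directionalWidth (strip f (a i.castSucc) (a i.succ)) x + a' / lam
            + Real.sqrt (2 * b' / lam)) := by
    intro W hW hWm a' b' ha' hb' hWab hg i x hx
    obtain ⟨ν, hν⟩ := hdir i x hx
    exact abs_averageApprox_sub_le hf hR hlam1 hVR hKV (hΓ _) (union_subset (hΓ _) (hΓ _))
      (hmono (Fin.le_last _)) hf'V hf'B hA₀ hM.le hW hWm ha' hb' hWab hg hx hν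
  refine ⟨fun a' b' ha' hb' hab i x hx => ?_, fun L hL hfL L' hL' i x hx => ?_⟩
  · have hmaj : ∀ t, 0 ≤ t → modulus f' t ≤ concaveModulus f' t := fun t ht =>
      le_leastConcaveMajorant (modulus_le hA₀) ht
    have hconc : ConcaveOn ℝ (Ici 0) (concaveModulus f') :=
      concaveOn_leastConcaveMajorant (modulus_le hA₀)
    exact hbound _ hconc
      (monotoneOn_of_concaveOn_of_nonneg hconc fun t ht =>
        (modulus_nonneg f' t).trans (hmaj t ht)) a' b' ha' hb' hab
      (fun u _ v _ => (abs_sub_le_modulus hA₀ le_rfl).trans (hmaj _ (norm_nonneg _))) i x hx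
  · have hlip : ∀ u ∈ sublevelSet f α ∪ (ball 0 (R + 1))ᶜ, ∀ v ∈ sublevelSet f α,
        |f' u - f' v| ≤ L' * ‖u - v‖ := by
      intro u hu v hv
      have hballs : (ball (0 : E n) (R + 1))ᶜ ⊆ (ball 0 R)ᶜ :=
        compl_subset_compl.2 (ball_subset_ball (by linarith))
      rcases hL' with h | h
      · have := h.dist_le_mul u (hu.imp_right fun h' => hballs h') v (Or.inl hv)
        rwa [Real.dist_eq, dist_eq_norm] at this
      · rcases hu with hu | hu
        · have h1 := hfL.dist_le_mul u v
          rw [Real.dist_eq, dist_eq_norm] at h1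
          rw [hf'V u hu, hf'V v hv]
          refine h1.trans (mul_le_mul_of_nonneg_right ?_ (norm_nonneg _))
          rw [h]
          exact le_max_left _ _
        · -- here `u` is at distance at least `1` from `V_α`
          have hdist : 1 ≤ ‖u - v‖ := by
            have h1 : R + 1 ≤ ‖u‖ := by simpa using hu
            have h2 : ‖v‖ < R := by simpa using hVR hv
            linarith [norm_sub_norm_le u v]
          have hbdd : BddAbove ((fun y => |f y|) '' sublevelSet f α) :=
            (hVc (Fin.last m)).bddAbove_image hf.abs.continuousOn
          have h3 : |f v| ≤ sSup ((fun y => |f y|) '' sublevelSet f α) :=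
            le_csSup hbdd ⟨v, hv, rfl⟩
          rw [hf'B u (hballs hu), hf'V v hv]
          calc |α + 1 - f v| ≤ |α + 1| + |f v| := abs_sub _ _
            _ ≤ L' := by
              rw [h]
              exact le_trans (by linarith) (le_max_right _ _)
            _ ≤ L' * ‖u - v‖ := le_mul_of_one_le_right L'.2 hdist
    have hconc : ConcaveOn ℝ (Ici 0) fun t : ℝ => (L' : ℝ) * t :=
      (concaveOn_id (convex_Ici 0)).smul L'.2
    have h := hbound (fun t => L' * t) hconc
      (fun s _ t _ hst => mul_le_mul_of_nonneg_left hst L'.2) L' 0 L'.2 le_rfl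
      (fun t _ => by simp) hlip i x hx
    simp only [mul_zero, zero_div, Real.sqrt_zero, add_zero] at h
    calc _ ≤ _ := h
      _ = _ := by ring
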